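/- Let $f,g$ be non-degenerate real quadratic forms on $\mathbb R^3$. For a ternary quadratic form $q$ write $\operatorname{Disc}(q)$ for the determinant of its symmetric matrix. Put $\phi(t)=\operatorname{Disc}(tf+g)=\Phi_{30}t^3+\Phi_{21}t^2+\Phi_{12}t+\Phi_{03}$, and let $\psi(t)$ be the coefficient of $v$ in $\det\bigl(vI-\operatorname{Matrix}(tf+g)\bigr)=v^3-\mu(t)v^2+\psi(t)v-\phi(t)$. Let $P=p_2t^2+p_1t+p_0$ be the remainder of $\Phi_{30}\,\psi\,\phi'$ in the Euclidean division by $\phi$, and let $$A_1=\begin{vmatrix}\Phi_{30}&\Phi_{21}&\Phi_{12}\\0&p_2&p_1\\p_2&p_1&p_0\end{vmatrix}.$$ Say that $f,g$ generate a pencil in orbit II, IIa, III or IIIa if an invertible linear change of variables carries the span of $f,g$ onto the span of, respectively, $\{yz,\;x(y-z)\}$, $\{y^2+z^2,\;xz\}$, $\{xz,\;y^2\}$, $\{x^2+y^2,\;z^2\}$. (1) Suppose that $f,g$ generate a pencil in orbit II or IIa. The orbit is II if and only if $p_2<0$ and $\Phi_{30}A_1>0$; the orbit is IIa if and only if $p_2=0$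 or $\Phi_{30}A_1<0$. (2) Suppose that $f,g$ generate a pencil in orbit III or IIIa. The orbit is III if and only if $p_2<0$; the orbit is IIIa if and only if $p_2>0$. (3) Among the conics of the pencil generated by $f,g$ (the points of the projective line associated with the span of $f,g$), the numbers of pairs of distinct real lines, of conics whose real zero locus is a single point, and of double lines are, respectively, $2,0,0$ for orbit II; $1,1,0$ for orbit IIa; $1,0,1$ for orbit III; $0,1,1$ for orbit IIIa. The Sturm query of $\psi$ for $\phi$, that is, the number of distinct real roots of $\phi$ at which $\psi>0$ minus the number of those at which $\psi<0$, is $-2$ for orbit II, $0$ for orbit IIa, $-1$ for orbit III and $1$ for orbit IIIa. -/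

import Mathlib

open Polynomial

noncomputable section

namespace ConicPencil

/-- Real ternary quadratic forms. -/
abbrev TernaryForm : Type := QuadraticForm ℝ (Fin 3 → ℝ)

/-- `Disc(f)`: the determinant of the (symmetric) matrix of `f`. -/
def disc (f : TernaryForm) : ℝ := QuadraticForm.discr' f

/-- The subspace of quadratic forms spanned by `f` and `g`. -/
def pencil (f g : TernaryForm) : Submodule ℝ TernaryForm := Submodule.span ℝ {f, g}

/-- Two spaces of quadratic forms are equivalent if an invertible linear change of variables
carries one onto the other (scalar matrices act trivially, so this is the action of
`PGL(3, ℝ)` on pencils). -/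
def Equivalent (P Q : Submodule ℝ TernaryForm) : Prop :=
  ∃ e : (Fin 3 → ℝ) ≃ₗ[ℝ] (Fin 3 → ℝ), ∀ q : TernaryForm,
    q ∈ P ↔ q.comp (e : (Fin 3 → ℝ) →ₗ[ℝ] (Fin 3 → ℝ)) ∈ Q

/-- The coordinate linear form `x`. -/
def xForm : (Fin 3 → ℝ) →ₗ[ℝ] ℝ := LinearMap.proj 0

/-- The coordinate linear form `y`. -/
def yForm : (Fin 3 → ℝ) →ₗ[ℝ] ℝ := LinearMap.proj 1

/-- The coordinate linear form `z`. -/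
def zForm : (Fin 3 → ℝ) →ₗ[ℝ] ℝ := LinearMap.proj 2

/-- The product of two linear forms, as a quadratic form. -/
def mulForm (l m : (Fin 3 → ℝ) →ₗ[ℝ] ℝ) : TernaryForm := QuadraticMap.linMulLin l m

/-- The four orbits concerned, in Levy's nomenclature. -/
inductive Orbit
  | II | IIa | III | IIIa

/-- Levy's representatives of the four orbits. -/
def Orbit.representative : Orbit → Submodule ℝ TernaryForm
  | .II => pencil (mulForm yForm zForm) (mulForm xForm (yForm - zForm))
  | .IIa => pencil (mulForm yForm yForm + mulForm zForm zForm) (mulForm xForm zForm)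
  | .III => pencil (mulForm xForm zForm) (mulForm yForm yForm)
  | .IIIa => pencil (mulForm xForm xForm + mulForm yForm yForm) (mulForm zForm zForm)

/-- `f` and `g` generate a pencil in the orbit `o`. -/
def GeneratesIn (o : Orbit) (f g : TernaryForm) : Prop :=
  Equivalent (pencil f g) o.representative

/-- The matrix of `t f + g`, with `t` an indeterminate. -/
def pencilMatrix (f g : TernaryForm) : Matrix (Fin 3) (Fin 3) ℝ[X] :=
  (X : ℝ[X]) • (QuadraticForm.toMatrix' f).map C + (QuadraticForm.toMatrix' g).map C

/-- The dehomogenized characteristic form `φ(t) = Disc(t f + g)`; its coefficients of degrees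
`3, 2, 1, 0` are the coefficients `Φ₃₀, Φ₂₁, Φ₁₂, Φ₀₃` of the characteristic form
`Disc(t f + u g)`. -/
def phi (f g : TernaryForm) : ℝ[X] := (pencilMatrix f g).det

/-- `ψ(t)`, the coefficient of `v` in `det(v I - Matrix(t f + g))`, which is
`v³ - μ(t) v² + ψ(t) v - φ(t)`. -/
def psi (f g : TernaryForm) : ℝ[X] := (pencilMatrix f g).charpoly.coeff 1

/-- `Φ₃₀`, the coefficient of `t³` in the characteristic form. -/
def Phi30 (f g : TernaryForm) : ℝ := (phi f g).coeff 3

/-- The remainder `P = p₂ t² + p₁ t + p₀` of `Φ₃₀ ψ φ'` in the division by `φ`. -/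
def remP (f g : TernaryForm) : ℝ[X] :=
  (C (Phi30 f g) * psi f g * derivative (phi f g)) % phi f g

/-- The coefficient `p₂` of `P`. -/
def p2 (f g : TernaryForm) : ℝ := (remP f g).coeff 2

/-- The signed subresultant principal coefficient `sr₁(V, W)`, for `V` of degree three and
`W` of degree at most two. -/
def sr1 (V W : ℝ[X]) : ℝ :=
  Matrix.det !![V.coeff 3, V.coeff 2, V.coeff 1;
                0,         W.coeff 2, W.coeff 1;
                W.coeff 2, W.coeff 1, W.coeff 0]

/-- `A₁ = sr₁(φ, P)`. -/
def A1 (f g : TernaryForm) : ℝ := sr1 (phi f g) (remP f g)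

/-- The Sturm query of `U` for `V`: the number of distinct real roots of `V` at which `U` is
positive, minus the number of those at which `U` is negative. -/
def sturmQuery (U V : ℝ[X]) : ℤ :=
  ({t ∈ V.roots.toFinset | 0 < U.eval t}.card : ℤ) -
    ({t ∈ V.roots.toFinset | U.eval t < 0}.card : ℤ)

/-- The conic of `q` is a pair of distinct real lines. -/
def IsPairOfLines (q : TernaryForm) : Prop :=
  ∃ l m : (Fin 3 → ℝ) →ₗ[ℝ] ℝ, LinearIndependent ℝ ![l, m] ∧ q = mulForm l m

/-- The zero locus of `q` in the real projective plane is a single point. -/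
def IsIsolatedPoint (q : TernaryForm) : Prop :=
  ∃ v : Fin 3 → ℝ, v ≠ 0 ∧ ∀ w : Fin 3 → ℝ, q w = 0 ↔ w ∈ Submodule.span ℝ {v}

/-- The conic of `q` is a double line. -/
def IsDoubleLine (q : TernaryForm) : Prop :=
  ∃ (c : ℝ) (l : (Fin 3 → ℝ) →ₗ[ℝ] ℝ), c ≠ 0 ∧ l ≠ 0 ∧ q = c • mulForm l l

/-- Among the conics of the pencil generated by `f` and `g`, exactly `a` are pairs of lines,
`b` are isolated points and `c` are double lines. The conics of the pencil are the points of
the projective line of the plane `pencil f g`. -/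
def HasDegenerateConics (f g : TernaryForm) (a b c : ℕ) : Prop :=
  {p : Projectivization ℝ TernaryForm | p.rep ∈ pencil f g ∧ IsPairOfLines p.rep}.encard = a ∧
  {p : Projectivization ℝ TernaryForm | p.rep ∈ pencil f g ∧ IsIsolatedPoint p.rep}.encard = b ∧
  {p : Projectivization ℝ TernaryForm | p.rep ∈ pencil f g ∧ IsDoubleLine p.rep}.encard = c

/-- `φ(t) = Disc(t f + g)`. -/
theorem eval_phi (f g : TernaryForm) (t : ℝ) : (phi f g).eval t = disc (t • f + g) := by
  have h : (pencilMatrix f g).map (eval t) = QuadraticForm.toMatrix' (t • f + g) := by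
    ext i j
    simp [pencilMatrix, QuadraticForm.toMatrix']
    ring
  rw [disc, QuadraticForm.discr', ← h, phi, Matrix.det_fin_three, Matrix.det_fin_three]
  simp

/-- `Φ₃₀ = Disc(f)`. -/
theorem Phi30_eq (f g : TernaryForm) : Phi30 f g = disc f := by
  have h := Polynomial.coeff_det_X_add_C_card (QuadraticForm.toMatrix' f)
    (QuadraticForm.toMatrix' g)
  simpa [Phi30, phi, pencilMatrix, disc, QuadraticForm.discr'] using h

end ConicPencil

end

open ConicPencil

noncomputable section

namespace ConicPencil

/-! Up to a nonzero constant, the four representatives have the same characteristic form `r² s`,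
with one double and one simple root. Since `disc f ≠ 0`, no root lies at infinity: `φ = Φ₃₀ (t - a)²
(t - b)` with real `a ≠ b`, and `a f + g`, `b f + g` are the only degenerate conics of the pencil.
Their kinds survive scaling and linear changes of variables, so they are read off the representative
(`GeneratesIn.exists_roots`), and this gives the counts of conics.

The polynomial `ψ` is not invariant, but its sign at a root of `φ` is: there `ψ` is the product of
the two remaining eigenvalues of a singular symmetric matrix, hence negative for a pair of real
lines, positive for a sum of two squares up to scale, zero for a double line. This gives the Sturm
queries.

It remains to detect these signs without the roots. Modulo `φ`, `P` is `Φ₃₀ ψ φ'`, which fixes its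
value at `b` and its value and derivative at `a`. Hence `p₂ = Φ₃₀² (ψ(b) + 2 ψ(a))` (`p2_eq`), and
`Φ₃₀ A₁` is a positive multiple of `ψ(a) ψ(b)` (`Phi30_mul_A1`). For III and IIIa, `ψ(a) = 0` and
`p₂` has the sign of `ψ(b)`; for II and IIa, `ψ(b) < 0` and the sign of the product decides. -/

/-! ### Matrices of forms and the polynomial `ψ` -/

/-- The sum of the principal minors of size two of a matrix of size three. -/
def principalMinorSum {R : Type*} [CommRing R] (M : Matrix (Fin 3) (Fin 3) R) : R :=
  M 0 0 * M 1 1 - M 0 1 * M 1 0 + (M 0 0 * M 2 2 - M 0 2 * M 2 0) +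
    (M 1 1 * M 2 2 - M 1 2 * M 2 1)

theorem charpoly_coeff_one {R : Type*} [CommRing R] (M : Matrix (Fin 3) (Fin 3) R) :
    M.charpoly.coeff 1 = principalMinorSum M := by
  have h : M.charpoly = X ^ 3 - C (M 0 0 + M 1 1 + M 2 2) * X ^ 2 +
      C (principalMinorSum M) * X - C M.det := by
    rw [Matrix.charpoly, Matrix.det_fin_three, Matrix.det_fin_three]
    simp [principalMinorSum]
    ring
  rw [h]
  simp only [coeff_sub, coeff_add, coeff_C_mul, coeff_X_pow, coeff_C, coeff_X]
  simp

theorem toMatrix'_entry (q : TernaryForm) (i j : Fin 3) :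
    QuadraticForm.toMatrix' q i j =
      (q (Pi.single i 1 + Pi.single j 1) - q (Pi.single i 1) - q (Pi.single j 1)) / 2 := by
  simp [QuadraticForm.toMatrix', LinearMap.toMatrix₂'_apply, QuadraticMap.associated_apply]
  ring

theorem toMatrix'_add (p q : TernaryForm) :
    QuadraticForm.toMatrix' (p + q) = QuadraticForm.toMatrix' p + QuadraticForm.toMatrix' q := by
  simp [QuadraticForm.toMatrix']

/-- The vector of coefficients of a linear form. -/
def coeffs (l : (Fin 3 → ℝ) →ₗ[ℝ] ℝ) : Fin 3 → ℝ := fun i => l (Pi.single i 1)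

theorem toMatrix'_mulForm (l m : (Fin 3 → ℝ) →ₗ[ℝ] ℝ) (i j : Fin 3) :
    QuadraticForm.toMatrix' (mulForm l m) i j =
      (coeffs l i * coeffs m j + coeffs l j * coeffs m i) / 2 := by
  rw [toMatrix'_entry]
  simp [mulForm, coeffs]
  ring

theorem eval_psi (f g : TernaryForm) (t : ℝ) :
    (psi f g).eval t = principalMinorSum (QuadraticForm.toMatrix' (t • f + g)) := by
  rw [psi, charpoly_coeff_one, toMatrix'_add, QuadraticForm.toMatrix'_smul]
  simp [principalMinorSum, pencilMatrix, mul_comm t]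

theorem apply_eq_sum (l : (Fin 3 → ℝ) →ₗ[ℝ] ℝ) (w : Fin 3 → ℝ) :
    l w = coeffs l 0 * w 0 + coeffs l 1 * w 1 + coeffs l 2 * w 2 := by
  rw [LinearMap.pi_apply_eq_sum_univ l w]
  have h (i : Fin 3) : (fun j => if i = j then (1 : ℝ) else 0) = Pi.single i 1 := by
    ext j
    simp [Pi.single_apply, eq_comm]
  simp only [Fin.sum_univ_three, h, coeffs, smul_eq_mul]
  ring

theorem coeffs_ne_zero {l : (Fin 3 → ℝ) →ₗ[ℝ] ℝ} (hl : l ≠ 0) : coeffs l ≠ 0 := by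
  rintro h
  apply hl
  ext w
  simpa [coeffs] using congrFun h w

theorem cross_coeffs_ne_zero {l m : (Fin 3 → ℝ) →ₗ[ℝ] ℝ} (h : LinearIndependent ℝ ![l, m]) :
    crossProduct (coeffs l) (coeffs m) ≠ 0 := by
  rw [crossProduct_ne_zero_iff_linearIndependent]
  rw [LinearIndependent.pair_iff] at h ⊢
  intro s t hst
  apply h s t
  by_contra hne
  refine coeffs_ne_zero hne ?_
  rw [← hst]
  ext i
  simp [coeffs]

theorem sum_sq_pos {v : Fin 3 → ℝ} (hv : v ≠ 0) : 0 < v 0 ^ 2 + v 1 ^ 2 + v 2 ^ 2 := by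
  by_contra! h
  apply hv
  ext i
  have h0 := sq_nonneg (v 0)
  have h1 := sq_nonneg (v 1)
  have h2 := sq_nonneg (v 2)
  fin_cases i <;> simp <;> exact pow_eq_zero_iff two_ne_zero |>.1 (by linarith)

/-! ### Signs of `ψ` and vanishing of the discriminant on degenerate conics -/

/-- The form is, up to a scalar, the sum of the squares of two independent linear forms. -/
def IsSumOfSquares (q : TernaryForm) : Prop :=
  ∃ (c : ℝ) (l m : (Fin 3 → ℝ) →ₗ[ℝ] ℝ), c ≠ 0 ∧ LinearIndependent ℝ ![l, m] ∧
    q = c • (mulForm l l + mulForm m m)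

/-- With `a`, `b` the coefficient vectors of the two lines, the sum equals `-|a × b|² / 4`. -/
theorem IsPairOfLines.principalMinorSum_neg {q : TernaryForm} (h : IsPairOfLines q) :
    principalMinorSum (QuadraticForm.toMatrix' q) < 0 := by
  obtain ⟨l, m, hlm, rfl⟩ := h
  have h := sum_sq_pos (cross_coeffs_ne_zero hlm)
  simp [cross_apply] at h
  simp only [principalMinorSum, toMatrix'_mulForm]
  linarith

/-- By Lagrange's identity the sum equals `c² |a × b|²`. -/
theorem IsSumOfSquares.principalMinorSum_pos {q : TernaryForm} (h : IsSumOfSquares q) :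
    0 < principalMinorSum (QuadraticForm.toMatrix' q) := by
  obtain ⟨c, l, m, hc, hlm, rfl⟩ := h
  have h := mul_pos (sq_pos_of_ne_zero hc) (sum_sq_pos (cross_coeffs_ne_zero hlm))
  simp [cross_apply] at h
  simp only [principalMinorSum, QuadraticForm.toMatrix'_smul, toMatrix'_add, Matrix.smul_apply,
    Matrix.add_apply, toMatrix'_mulForm, smul_eq_mul]
  linarith

theorem IsDoubleLine.principalMinorSum_eq_zero {q : TernaryForm} (h : IsDoubleLine q) :
    principalMinorSum (QuadraticForm.toMatrix' q) = 0 := by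
  obtain ⟨c, l, hc, hl, rfl⟩ := h
  simp only [principalMinorSum, QuadraticForm.toMatrix'_smul, Matrix.smul_apply,
    toMatrix'_mulForm, smul_eq_mul]
  ring

theorem IsPairOfLines.disc_eq_zero {q : TernaryForm} (h : IsPairOfLines q) : disc q = 0 := by
  obtain ⟨l, m, hlm, rfl⟩ := h
  simp only [disc, QuadraticForm.discr', Matrix.det_fin_three, toMatrix'_mulForm]
  ring

theorem IsDoubleLine.disc_eq_zero {q : TernaryForm} (h : IsDoubleLine q) : disc q = 0 := by
  obtain ⟨c, l, hc, hl, rfl⟩ := h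
  simp only [disc, QuadraticForm.discr', Matrix.det_fin_three, QuadraticForm.toMatrix'_smul,
    Matrix.smul_apply, toMatrix'_mulForm, smul_eq_mul]
  ring

/-- The isolated zero `v` is a singular point: if `v` were not polar to some `w`, the line joining
them would meet the conic at a second point. So `v` lies in the kernel of the matrix. -/
theorem IsIsolatedPoint.disc_eq_zero {q : TernaryForm} (h : IsIsolatedPoint q) :
    disc q = 0 := by
  obtain ⟨v, hv, hq⟩ := h
  have hv0 : q v = 0 := (hq v).2 (Submodule.mem_span_singleton_self v)
  have hpolar (w : Fin 3 → ℝ) : QuadraticMap.polar q v w = 0 := by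
    by_contra hne
    -- As `q v = 0`, `q` is affine in `c` along `w + c v`, with slope the polar of `w` and `v`; this
    -- is its root.
    have hz : q (w + (-q w / QuadraticMap.polar q v w) • v) = 0 := by
      have := QuadraticMap.map_add q w ((-q w / QuadraticMap.polar q v w) • v)
      rw [this, QuadraticMap.map_smul, QuadraticMap.polar_smul_right,
        QuadraticMap.polar_comm q w v, hv0]
      simp only [smul_eq_mul]
      field_simp
      ring
    have hw : w ∈ Submodule.span ℝ {v} := by
      have := Submodule.sub_mem _ ((hq _).1 hz) (Submodule.smul_mem _
        (-q w / QuadraticMap.polar q v w) (Submodule.mem_span_singleton_self v))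
      simpa using this
    obtain ⟨c, rfl⟩ := Submodule.mem_span_singleton.1 hw
    simp [hv0] at hne
  rw [disc, QuadraticForm.discr', ← Matrix.exists_mulVec_eq_zero_iff]
  refine ⟨v, hv, ?_⟩
  ext i
  have h2 : QuadraticMap.associated q (Pi.single i 1) v = 0 := by
    have := hpolar (Pi.single i 1)
    rw [QuadraticMap.polar_comm, QuadraticMap.polar] at this
    simp [QuadraticMap.associated_apply, this]
  rw [← Matrix.toLinearMap₂'_toMatrix' (R := ℝ) (QuadraticMap.associated q),
    Matrix.toLinearMap₂'_apply'] at h2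
  simpa [QuadraticForm.toMatrix'] using h2

/-! ### Invariance of the kinds under scaling and change of variables -/

theorem IsIsolatedPoint.smul {q : TernaryForm} (h : IsIsolatedPoint q) {c : ℝ} (hc : c ≠ 0) :
    IsIsolatedPoint (c • q) := by
  obtain ⟨v, hv, hq⟩ := h
  exact ⟨v, hv, fun w => by simp [hc, hq]⟩

theorem IsPairOfLines.smul {q : TernaryForm} (h : IsPairOfLines q) {c : ℝ} (hc : c ≠ 0) :
    IsPairOfLines (c • q) := by
  obtain ⟨l, m, hlm, rfl⟩ := h
  refine ⟨c • l, m, ?_, ?_⟩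
  · rw [LinearIndependent.pair_iff] at hlm ⊢
    intro s t hst
    have := hlm (s * c) t (by rw [← hst, smul_smul])
    simpa [hc] using this
  · ext w
    simp [mulForm, mul_assoc]

theorem IsDoubleLine.smul {q : TernaryForm} (h : IsDoubleLine q) {c : ℝ} (hc : c ≠ 0) :
    IsDoubleLine (c • q) := by
  obtain ⟨d, l, hd, hl, rfl⟩ := h
  exact ⟨c * d, l, mul_ne_zero hc hd, hl, smul_smul _ _ _⟩

theorem IsSumOfSquares.smul {q : TernaryForm} (h : IsSumOfSquares q) {c : ℝ} (hc : c ≠ 0) :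
    IsSumOfSquares (c • q) := by
  obtain ⟨d, l, m, hd, hl, rfl⟩ := h
  exact ⟨c * d, l, m, mul_ne_zero hc hd, hl, smul_smul _ _ _⟩

theorem mulForm_comp (l m : (Fin 3 → ℝ) →ₗ[ℝ] ℝ) (e : (Fin 3 → ℝ) →ₗ[ℝ] (Fin 3 → ℝ)) :
    (mulForm l m).comp e = mulForm (l ∘ₗ e) (m ∘ₗ e) := by
  ext w
  simp [mulForm]

theorem comp_pair_linearIndependent {l m : (Fin 3 → ℝ) →ₗ[ℝ] ℝ}
    (h : LinearIndependent ℝ ![l, m]) (e : (Fin 3 → ℝ) ≃ₗ[ℝ] (Fin 3 → ℝ)) :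
    LinearIndependent ℝ ![l ∘ₗ (e : (Fin 3 → ℝ) →ₗ[ℝ] (Fin 3 → ℝ)), m ∘ₗ ↑e] := by
  rw [LinearIndependent.pair_iff] at h ⊢
  intro s t hst
  apply h s t
  ext w
  simpa using LinearMap.congr_fun hst (e.symm (Pi.single w 1))

theorem IsPairOfLines.comp {q : TernaryForm} (h : IsPairOfLines q)
    (e : (Fin 3 → ℝ) ≃ₗ[ℝ] (Fin 3 → ℝ)) :
    IsPairOfLines (q.comp (e : (Fin 3 → ℝ) →ₗ[ℝ] (Fin 3 → ℝ))) := by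
  obtain ⟨l, m, hlm, rfl⟩ := h
  exact ⟨_, _, comp_pair_linearIndependent hlm e, mulForm_comp _ _ _⟩

theorem smul_comp (c : ℝ) (q : TernaryForm) (e : (Fin 3 → ℝ) →ₗ[ℝ] (Fin 3 → ℝ)) :
    (c • q).comp e = c • q.comp e := rfl

theorem add_comp (p q : TernaryForm) (e : (Fin 3 → ℝ) →ₗ[ℝ] (Fin 3 → ℝ)) :
    (p + q).comp e = p.comp e + q.comp e := rfl

theorem IsDoubleLine.comp {q : TernaryForm} (h : IsDoubleLine q)
    (e : (Fin 3 → ℝ) ≃ₗ[ℝ] (Fin 3 → ℝ)) :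
    IsDoubleLine (q.comp (e : (Fin 3 → ℝ) →ₗ[ℝ] (Fin 3 → ℝ))) := by
  obtain ⟨c, l, hc, hl, rfl⟩ := h
  refine ⟨c, l ∘ₗ (e : (Fin 3 → ℝ) →ₗ[ℝ] (Fin 3 → ℝ)), hc, fun h => hl ?_, ?_⟩
  · ext w
    simpa using LinearMap.congr_fun h (e.symm (Pi.single w 1))
  · rw [smul_comp, mulForm_comp]

theorem IsSumOfSquares.comp {q : TernaryForm} (h : IsSumOfSquares q)
    (e : (Fin 3 → ℝ) ≃ₗ[ℝ] (Fin 3 → ℝ)) :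
    IsSumOfSquares (q.comp (e : (Fin 3 → ℝ) →ₗ[ℝ] (Fin 3 → ℝ))) := by
  obtain ⟨c, l, m, hc, hlm, rfl⟩ := h
  refine ⟨c, _, _, hc, comp_pair_linearIndependent hlm e, ?_⟩
  rw [smul_comp, add_comp, mulForm_comp, mulForm_comp]

/-! ### Isolated points and mutual exclusion of the kinds -/

theorem IsSumOfSquares.isIsolatedPoint {q : TernaryForm} (h : IsSumOfSquares q) :
    IsIsolatedPoint q := by
  obtain ⟨c, l, m, hc, hlm, rfl⟩ := h
  have hn := cross_coeffs_ne_zero hlm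
  have hpos := sum_sq_pos hn
  refine ⟨_, hn, fun w => ?_⟩
  have hzero : (c • (mulForm l l + mulForm m m)) w = 0 ↔ l w = 0 ∧ m w = 0 := by
    simp [mulForm, ← mul_add, hc, mul_self_add_mul_self_eq_zero]
  rw [hzero, Submodule.mem_span_singleton, apply_eq_sum l, apply_eq_sum m]
  generalize coeffs l = a at *
  generalize coeffs m = b at *
  constructor
  · rintro ⟨hl, hm⟩
    simp only [cross_apply, Matrix.cons_val] at hpos
    -- With `n = a × b`, the scalar is that of the orthogonal projection onto `n`. The coordinates
    -- below come from `(n·w) n - |n|² w = l(w) (n × b) - m(w) (n × a)`.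
    refine ⟨(w 0 * (a 1 * b 2 - a 2 * b 1) + w 1 * (a 2 * b 0 - a 0 * b 2) +
      w 2 * (a 0 * b 1 - a 1 * b 0)) / ((a 1 * b 2 - a 2 * b 1) ^ 2 +
      (a 2 * b 0 - a 0 * b 2) ^ 2 + (a 0 * b 1 - a 1 * b 0) ^ 2), ?_⟩
    have hne := hpos.ne'
    ext i
    fin_cases i <;> simp [cross_apply] <;> rw [div_mul_eq_mul_div, div_eq_iff hne]
    · linear_combination ((a 2 * b 0 - a 0 * b 2) * b 2 - (a 0 * b 1 - a 1 * b 0) * b 1) * hl -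
        ((a 2 * b 0 - a 0 * b 2) * a 2 - (a 0 * b 1 - a 1 * b 0) * a 1) * hm
    · linear_combination ((a 0 * b 1 - a 1 * b 0) * b 0 - (a 1 * b 2 - a 2 * b 1) * b 2) * hl -
        ((a 0 * b 1 - a 1 * b 0) * a 0 - (a 1 * b 2 - a 2 * b 1) * a 2) * hm
    · linear_combination ((a 1 * b 2 - a 2 * b 1) * b 1 - (a 2 * b 0 - a 0 * b 2) * b 0) * hl -
        ((a 1 * b 2 - a 2 * b 1) * a 1 - (a 2 * b 0 - a 0 * b 2) * a 0) * hm
  · rintro ⟨k, rfl⟩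
    simp [cross_apply]
    constructor <;> ring

/-- The kernel of a nonzero linear form is a plane and does not fit in the line of zeros of `q`. -/
theorem IsIsolatedPoint.eq_zero_of_apply_eq_zero {q : TernaryForm} (h : IsIsolatedPoint q)
    {l : (Fin 3 → ℝ) →ₗ[ℝ] ℝ} (hl : ∀ w, l w = 0 → q w = 0) : l = 0 := by
  obtain ⟨v, hv, hq⟩ := h
  by_contra hne
  have hk : LinearMap.ker l ≤ Submodule.span ℝ {v} := fun w hw => (hq w).1 (hl w hw)
  have h1 := Submodule.finrank_mono hk
  have h2 := LinearMap.finrank_range_add_finrank_ker l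
  have h3 : Module.finrank ℝ (LinearMap.range l) ≤ 1 := by
    simpa using Submodule.finrank_le (LinearMap.range l)
  rw [finrank_span_singleton hv] at h1
  simp at h2
  omega

theorem IsPairOfLines.not_isIsolatedPoint {q : TernaryForm} (h : IsPairOfLines q) :
    ¬IsIsolatedPoint q := by
  obtain ⟨l, m, hlm, rfl⟩ := h
  intro hi
  refine hlm.ne_zero 0 (hi.eq_zero_of_apply_eq_zero (l := l) fun w hw => ?_)
  simp [mulForm, hw]

theorem IsDoubleLine.not_isIsolatedPoint {q : TernaryForm} (h : IsDoubleLine q) :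
    ¬IsIsolatedPoint q := by
  obtain ⟨c, l, hc, hl, rfl⟩ := h
  intro hi
  refine hl (hi.eq_zero_of_apply_eq_zero fun w hw => ?_)
  simp [mulForm, hw]

theorem IsPairOfLines.not_isDoubleLine {q : TernaryForm} (h : IsPairOfLines q) :
    ¬IsDoubleLine q :=
  fun h' => h.principalMinorSum_neg.ne h'.principalMinorSum_eq_zero

theorem IsSumOfSquares.not_isDoubleLine {q : TernaryForm} (h : IsSumOfSquares q) :
    ¬IsDoubleLine q :=
  fun h' => h.principalMinorSum_pos.ne' h'.principalMinorSum_eq_zero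

theorem IsSumOfSquares.not_isPairOfLines {q : TernaryForm} (h : IsSumOfSquares q) :
    ¬IsPairOfLines q :=
  fun h' => h.principalMinorSum_pos.not_gt h'.principalMinorSum_neg

/-! ### Roots of the characteristic form -/

theorem disc_smul (c : ℝ) (q : TernaryForm) : disc (c • q) = c ^ 3 * disc q := by
  simp [disc, QuadraticForm.discr', QuadraticForm.toMatrix'_smul]

theorem disc_comp_equiv (e : (Fin 3 → ℝ) ≃ₗ[ℝ] (Fin 3 → ℝ)) :
    ∃ k : ℝ, k ≠ 0 ∧ ∀ q : TernaryForm,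
      disc (q.comp (e : (Fin 3 → ℝ) →ₗ[ℝ] (Fin 3 → ℝ))) = k * disc q := by
  refine ⟨_, ?_, fun q => QuadraticForm.discr'_comp _⟩
  rw [LinearMap.det_toMatrix', mul_self_ne_zero]
  exact e.isUnit_det'.ne_zero

/-- Two degenerate members `A`, `B` of the pencil spanned by `f` and `g`, whose characteristic
form is `k r² s`, are, up to scalars, the conics of parameters `a`, `b`, where `a` is a double
root and `b` a simple root of `φ`. -/
theorem exists_roots {f g A B : TernaryForm} (hf : disc f ≠ 0)
    (hP : pencil f g = pencil A B) {k : ℝ} (hk : k ≠ 0)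
    (hdisc : ∀ s r : ℝ, disc (s • A + r • B) = k * (r ^ 2 * s)) :
    ∃ a b : ℝ, a ≠ b ∧ phi f g = C (Phi30 f g) * (X - C a) ^ 2 * (X - C b) ∧
      (∃ c : ℝ, c ≠ 0 ∧ a • f + g = c • A) ∧ ∃ d : ℝ, d ≠ 0 ∧ b • f + g = d • B := by
  have key (D : TernaryForm) (hD : D ∈ pencil A B) (hD0 : disc D = 0) (hne : D ≠ 0) :
      ∃ a c : ℝ, c ≠ 0 ∧ a • f + g = c • D := by
    rw [← hP, pencil, Submodule.mem_span_pair] at hD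
    obtain ⟨u, v, rfl⟩ := hD
    -- The only member at infinity is `f`, which is nondegenerate.
    have hv : v ≠ 0 := by
      rintro rfl
      rw [zero_smul, add_zero, disc_smul] at hD0
      have hu : u = 0 := by simpa [hf] using hD0
      simp [hu] at hne
    refine ⟨v⁻¹ * u, v⁻¹, inv_ne_zero hv, ?_⟩
    rw [smul_add, smul_smul, smul_smul, inv_mul_cancel₀ hv, one_smul]
  have hA0 : disc A = 0 := by simpa using hdisc 1 0
  have hB0 : disc B = 0 := by simpa using hdisc 0 1
  have hA : A ≠ 0 := by
    rintro rfl
    have := hdisc 1 1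
    rw [smul_zero, zero_add, one_smul, hB0] at this
    exact hk (by simpa using this.symm)
  have hB : B ≠ 0 := by
    rintro rfl
    have := hdisc 1 1
    rw [smul_zero, add_zero, one_smul, hA0] at this
    exact hk (by simpa using this.symm)
  obtain ⟨a, c, hc, ha⟩ := key A (Submodule.subset_span (by simp)) hA0 hA
  obtain ⟨b, d, hd, hb⟩ := key B (Submodule.subset_span (by simp)) hB0 hB
  have hab : a ≠ b := by
    rintro rfl
    -- A common parameter would make `A` and `B` proportional, whereas the characteristic form at
    -- `(c, -d)` is `k d² c ≠ 0`.
    have h : c • A + (-d) • B = 0 := by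
      calc c • A + (-d) • B = c • A - d • B := by module
        _ = 0 := by rw [← ha, ← hb, sub_self]
    have h' := hdisc c (-d)
    rw [h] at h'
    simp [disc, QuadraticForm.discr', QuadraticForm.toMatrix', hk, hc, hd] at h'
  have hab' : a - b ≠ 0 := sub_ne_zero.2 hab
  have hphi : phi f g = C (k * d ^ 2 * c / (a - b) ^ 3) * (X - C a) ^ 2 * (X - C b) := by
    refine Polynomial.funext fun t => ?_
    -- Linear interpolation between the parameters `a` and `b`. The coefficient of `B` vanishes at
    -- `t = a`, and it enters the characteristic form squared, so `a` is the double root.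
    have h : t • f + g = ((t - b) / (a - b) * c) • A + (-(t - a) / (a - b) * d) • B := by
      rw [mul_smul, mul_smul, ← ha, ← hb]
      match_scalars <;> field_simp <;> ring
    rw [eval_phi, h, hdisc]
    simp only [eval_mul, eval_C, eval_pow, eval_sub, eval_X]
    field_simp
  refine ⟨a, b, hab, ?_, ⟨c, hc, ha⟩, d, hd, hb⟩
  have h30 : Phi30 f g = k * d ^ 2 * c / (a - b) ^ 3 := by
    rw [Phi30, hphi, mul_assoc, coeff_C_mul]
    have : ((X - C a) ^ 2 * (X - C b) : ℝ[X]) =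
        X ^ 3 - C (2 * a + b) * X ^ 2 + C (a ^ 2 + 2 * a * b) * X - C (a ^ 2 * b) := by
      simp only [map_add, map_mul, map_pow, C_ofNat]
      ring
    rw [this]
    simp only [coeff_sub, coeff_add, coeff_C_mul, coeff_X_pow, coeff_C, coeff_X]
    simp
  rw [h30]
  exact hphi

theorem pencil_eq_of_equiv {f g A B : TernaryForm} (e : (Fin 3 → ℝ) ≃ₗ[ℝ] (Fin 3 → ℝ))
    (h : ∀ q : TernaryForm,
      q ∈ pencil f g ↔ q.comp (e : (Fin 3 → ℝ) →ₗ[ℝ] (Fin 3 → ℝ)) ∈ pencil A B) :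
    pencil f g = pencil (A.comp (e.symm : (Fin 3 → ℝ) →ₗ[ℝ] (Fin 3 → ℝ)))
      (B.comp (e.symm : (Fin 3 → ℝ) →ₗ[ℝ] (Fin 3 → ℝ))) := by
  ext q
  rw [h, pencil, pencil, Submodule.mem_span_pair, Submodule.mem_span_pair]
  refine exists_congr fun u => exists_congr fun v => ⟨fun hq => ?_, fun hq => ?_⟩
  · ext w
    simpa using DFunLike.congr_fun hq (e.symm w)
  · rw [← hq]
    ext w
    simp

/-! ### The representatives and the kinds of their degenerate conics -/

/-- The generator at the double root of the characteristic form. -/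
def Orbit.double : Orbit → TernaryForm
  | .II => mulForm yForm zForm
  | .IIa => mulForm yForm yForm + mulForm zForm zForm
  | .III => mulForm yForm yForm
  | .IIIa => mulForm zForm zForm

/-- The generator at the simple root of the characteristic form. -/
def Orbit.simple : Orbit → TernaryForm
  | .II => mulForm xForm (yForm - zForm)
  | .IIa => mulForm xForm zForm
  | .III => mulForm xForm zForm
  | .IIIa => mulForm xForm xForm + mulForm yForm yForm

theorem Orbit.representative_eq (o : Orbit) : o.representative = pencil o.double o.simple := by
  cases o <;> simp only [representative, double, simple]
  · rw [pencil, pencil, Set.pair_comm]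
  · rw [pencil, pencil, Set.pair_comm]

/-- This common shape lets all four orbits be treated at once; only the kinds of the two generators
tell them apart. -/
theorem Orbit.disc_smul_add_smul (o : Orbit) : ∃ k : ℝ, k ≠ 0 ∧ ∀ s r : ℝ,
    disc (s • o.double + r • o.simple) = k * (r ^ 2 * s) := by
  have h : coeffs xForm = ![1, 0, 0] ∧ coeffs yForm = ![0, 1, 0] ∧ coeffs zForm = ![0, 0, 1] ∧
      coeffs (yForm - zForm) = ![0, 1, -1] := by
    refine ⟨?_, ?_, ?_, ?_⟩ <;> ext i <;> fin_cases i <;> simp [coeffs, xForm, yForm, zForm]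
  obtain ⟨hx, hy, hz, hyz⟩ := h
  cases o
  case IIIa =>
    refine ⟨1, one_ne_zero, fun s r => ?_⟩
    simp only [double, simple, disc, QuadraticForm.discr', Matrix.det_fin_three,
      toMatrix'_add, QuadraticForm.toMatrix'_smul, Matrix.smul_apply, Matrix.add_apply,
      toMatrix'_mulForm, hx, hy, hz, Matrix.cons_val, smul_eq_mul]
    ring
  all_goals
    refine ⟨-1 / 4, by norm_num, fun s r => ?_⟩
    simp only [double, simple, disc, QuadraticForm.discr', Matrix.det_fin_three,
      toMatrix'_add, QuadraticForm.toMatrix'_smul, Matrix.smul_apply, Matrix.add_apply,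
      toMatrix'_mulForm, hx, hy, hz, hyz, Matrix.cons_val, smul_eq_mul]
    ring

theorem linearIndependent_forms :
    LinearIndependent ℝ ![xForm, yForm] ∧ LinearIndependent ℝ ![xForm, zForm] ∧
    LinearIndependent ℝ ![yForm, zForm] ∧ LinearIndependent ℝ ![xForm, yForm - zForm] := by
  simp only [LinearIndependent.pair_iff]
  refine ⟨?_, ?_, ?_, ?_⟩ <;> intro s t h <;>
    have h0 := LinearMap.congr_fun h (Pi.single 0 1) <;>
    have h1 := LinearMap.congr_fun h (Pi.single 1 1) <;>
    have h2 := LinearMap.congr_fun h (Pi.single 2 1) <;>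
    simp [xForm, yForm, zForm] at h0 h1 h2 <;> simp [*]

/-- The kind of the conic at the double root of `φ`. -/
def Orbit.DoubleKind : Orbit → TernaryForm → Prop
  | .II => IsPairOfLines
  | .IIa => IsSumOfSquares
  | .III => IsDoubleLine
  | .IIIa => IsDoubleLine

/-- The kind of the conic at the simple root of `φ`. -/
def Orbit.SimpleKind : Orbit → TernaryForm → Prop
  | .II => IsPairOfLines
  | .IIa => IsPairOfLines
  | .III => IsPairOfLines
  | .IIIa => IsSumOfSquares

theorem Orbit.doubleKind_double (o : Orbit) (e : (Fin 3 → ℝ) ≃ₗ[ℝ] (Fin 3 → ℝ)) {c : ℝ}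
    (hc : c ≠ 0) :
    o.DoubleKind (c • o.double.comp (e : (Fin 3 → ℝ) →ₗ[ℝ] (Fin 3 → ℝ))) := by
  obtain ⟨hxy, hxz, hyz, hxyz⟩ := linearIndependent_forms
  cases o
  · exact (IsPairOfLines.comp ⟨_, _, hyz, rfl⟩ e).smul hc
  · exact (IsSumOfSquares.comp ⟨1, _, _, one_ne_zero, hyz, (one_smul _ _).symm⟩ e).smul hc
  · exact (IsDoubleLine.comp ⟨1, _, one_ne_zero, hyz.ne_zero 0, (one_smul _ _).symm⟩ e).smul hc
  · exact (IsDoubleLine.comp ⟨1, _, one_ne_zero, hyz.ne_zero 1, (one_smul _ _).symm⟩ e).smul hc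

theorem Orbit.simpleKind_simple (o : Orbit) (e : (Fin 3 → ℝ) ≃ₗ[ℝ] (Fin 3 → ℝ)) {c : ℝ}
    (hc : c ≠ 0) :
    o.SimpleKind (c • o.simple.comp (e : (Fin 3 → ℝ) →ₗ[ℝ] (Fin 3 → ℝ))) := by
  obtain ⟨hxy, hxz, hyz, hxyz⟩ := linearIndependent_forms
  cases o
  · exact (IsPairOfLines.comp ⟨_, _, hxyz, rfl⟩ e).smul hc
  · exact (IsPairOfLines.comp ⟨_, _, hxz, rfl⟩ e).smul hc
  · exact (IsPairOfLines.comp ⟨_, _, hxz, rfl⟩ e).smul hc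
  · exact (IsSumOfSquares.comp ⟨1, _, _, one_ne_zero, hxy, (one_smul _ _).symm⟩ e).smul hc

/-- Everything later that is drawn from membership in an orbit passes through this factorisation and
these two kinds. -/
theorem GeneratesIn.exists_roots {o : Orbit} {f g : TernaryForm} (hf : disc f ≠ 0)
    (h : GeneratesIn o f g) :
    ∃ a b : ℝ, a ≠ b ∧ phi f g = C (Phi30 f g) * (X - C a) ^ 2 * (X - C b) ∧
      o.DoubleKind (a • f + g) ∧ o.SimpleKind (b • f + g) := by
  obtain ⟨e, he⟩ := h
  rw [o.representative_eq] at he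
  obtain ⟨k, hk, hdisc⟩ := o.disc_smul_add_smul
  obtain ⟨m, hm, hcomp⟩ := disc_comp_equiv e.symm
  obtain ⟨a, b, hab, hphi, ⟨c, hc, hA⟩, d, hd, hB⟩ :=
    ConicPencil.exists_roots hf (pencil_eq_of_equiv e he) (mul_ne_zero hm hk) fun s r => by
      rw [← smul_comp, ← smul_comp, ← add_comp, hcomp, hdisc, mul_assoc]
  refine ⟨a, b, hab, hphi, ?_, ?_⟩
  · rw [hA]
    exact o.doubleKind_double e.symm hc
  · rw [hB]
    exact o.simpleKind_simple e.symm hd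

/-! ### The remainder `P`, its subresultant and the Sturm query -/

section roots

variable {f g : TernaryForm} {a b : ℝ}

theorem coeff_phi (hphi : phi f g = C (Phi30 f g) * (X - C a) ^ 2 * (X - C b)) :
    (phi f g).coeff 3 = Phi30 f g ∧ (phi f g).coeff 2 = -(Phi30 f g * (2 * a + b)) ∧
      (phi f g).coeff 1 = Phi30 f g * (a ^ 2 + 2 * a * b) := by
  refine ⟨rfl, ?_⟩
  have : ((X - C a) ^ 2 * (X - C b) : ℝ[X]) =
      X ^ 3 - C (2 * a + b) * X ^ 2 + C (a ^ 2 + 2 * a * b) * X - C (a ^ 2 * b) := by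
    simp only [map_add, map_mul, map_pow, C_ofNat]
    ring
  rw [hphi, mul_assoc, coeff_C_mul, coeff_C_mul, this]
  simp only [coeff_sub, coeff_add, coeff_C_mul, coeff_X_pow, coeff_C, coeff_X]
  constructor <;> simp <;> ring

theorem natDegree_phi (hf : Phi30 f g ≠ 0)
    (hphi : phi f g = C (Phi30 f g) * (X - C a) ^ 2 * (X - C b)) : (phi f g).natDegree = 3 := by
  rw [hphi, mul_assoc, natDegree_C_mul hf, Monic.natDegree_mul (by monicity!) (by monicity!)]
  simp

/-- The remainder `P` is determined by its values at both roots of `φ` and its derivative at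
the double root. -/
theorem remP_equations (hf : Phi30 f g ≠ 0)
    (hphi : phi f g = C (Phi30 f g) * (X - C a) ^ 2 * (X - C b)) :
    let p := remP f g
    p.coeff 2 * a ^ 2 + p.coeff 1 * a + p.coeff 0 = 0 ∧
    p.coeff 2 * b ^ 2 + p.coeff 1 * b + p.coeff 0 =
      Phi30 f g ^ 2 * (psi f g).eval b * (b - a) ^ 2 ∧
    2 * p.coeff 2 * a + p.coeff 1 = 2 * Phi30 f g ^ 2 * (psi f g).eval a * (a - b) := by
  intro p
  have hdeg : p.natDegree < 3 := by
    have h := natDegree_mod_lt (C (Phi30 f g) * psi f g * derivative (phi f g))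
      (q := phi f g) (by rw [natDegree_phi hf hphi]; norm_num)
    rwa [natDegree_phi hf hphi] at h
  have hp : p = C (p.coeff 2) * X ^ 2 + C (p.coeff 1) * X + C (p.coeff 0) := by
    conv_lhs => rw [p.as_sum_range_C_mul_X_pow' hdeg]
    simp [Finset.sum_range_succ]
    ring
  have hdiv := EuclideanDomain.div_add_mod (C (Phi30 f g) * psi f g * derivative (phi f g))
    (phi f g)
  change phi f g * _ + p = _ at hdiv
  generalize (C (Phi30 f g) * psi f g * derivative (phi f g)) / phi f g = Q at hdiv
  generalize Phi30 f g = K at *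
  rw [hphi] at hdiv
  have ha := congrArg (eval a) hdiv
  have hb := congrArg (eval b) hdiv
  -- The multiple of `φ` has a double zero at `a`, so it also drops out of the derivative there.
  have hd := congrArg (fun q => eval a (derivative q)) hdiv
  rw [hp] at ha hb hd
  simp [derivative_mul, derivative_pow] at ha hb hd
  refine ⟨ha, ?_, ?_⟩
  · rw [hb]
    ring
  · linear_combination hd

/-- Taylor's formula at `a`: `p₂ (b - a)² = P(b) - P(a) - (b - a) P'(a)`. The result weights the
values of `ψ` by the multiplicities of the roots. -/
theorem p2_eq (hf : Phi30 f g ≠ 0) (hab : a ≠ b)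
    (hphi : phi f g = C (Phi30 f g) * (X - C a) ^ 2 * (X - C b)) :
    p2 f g = Phi30 f g ^ 2 * ((psi f g).eval b + 2 * (psi f g).eval a) := by
  obtain ⟨h1, h2, h3⟩ := remP_equations hf hphi
  have h : (b - a) ^ 2 ≠ 0 := pow_ne_zero 2 (sub_ne_zero.2 hab.symm)
  rw [p2]
  apply mul_left_cancel₀ h
  linear_combination h2 - h1 - (b - a) * h3

/-- Since `P(a) = 0`, `P = (X - a) L`, and the subresultant is `-Φ₃₀ L(a) L(b)`, with `L(a) = P'(a)`
and `L(b) = P(b) / (b - a)`. -/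
theorem Phi30_mul_A1 (hf : Phi30 f g ≠ 0) (hab : a ≠ b)
    (hphi : phi f g = C (Phi30 f g) * (X - C a) ^ 2 * (X - C b)) :
    Phi30 f g * A1 f g =
      2 * Phi30 f g ^ 6 * (a - b) ^ 2 * ((psi f g).eval a * (psi f g).eval b) := by
  obtain ⟨h1, h2, h3⟩ := remP_equations hf hphi
  obtain ⟨c3, c2, c1⟩ := coeff_phi hphi
  have hp2 := p2_eq hf hab hphi
  rw [p2] at hp2
  have hp1 : (remP f g).coeff 1 = 2 * Phi30 f g ^ 2 * (psi f g).eval a * (a - b) -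
      2 * (remP f g).coeff 2 * a := by linear_combination h3
  have hp0 : (remP f g).coeff 0 = -((remP f g).coeff 2 * a ^ 2 + (remP f g).coeff 1 * a) := by
    linear_combination h1
  simp only [A1, sr1, Matrix.det_fin_three, c3, c2, c1]
  simp
  rw [hp0, hp1, hp2]
  ring

theorem sturmQuery_psi_phi (hf : Phi30 f g ≠ 0) (hab : a ≠ b)
    (hphi : phi f g = C (Phi30 f g) * (X - C a) ^ 2 * (X - C b)) :
    sturmQuery (psi f g) (phi f g) =
      SignType.sign ((psi f g).eval a) + SignType.sign ((psi f g).eval b) := by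
  have hroots : (phi f g).roots.toFinset = {a, b} := by
    have hne : phi f g ≠ 0 := by
      intro h
      simpa [h] using natDegree_phi hf hphi
    ext t
    rw [Multiset.mem_toFinset, mem_roots hne, hphi]
    simp [hf, sub_eq_zero]
  have key (u v : ℝ) : (∀ U : ℝ[X], U.eval a = u → U.eval b = v →
      (({t ∈ ({a, b} : Finset ℝ) | 0 < U.eval t}.card : ℤ) -
        ({t ∈ ({a, b} : Finset ℝ) | U.eval t < 0}.card : ℤ)) =
      SignType.sign u + SignType.sign v) := by
    rintro U rfl rfl
    rw [Finset.filter_insert, Finset.filter_insert, Finset.filter_singleton,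
      Finset.filter_singleton]
    rcases lt_trichotomy (U.eval a) 0 with ha | ha | ha <;>
      rcases lt_trichotomy (U.eval b) 0 with hb | hb | hb <;>
      simp [ha, hb, ha.not_gt, hb.not_gt, hab]
  rw [sturmQuery, hroots]
  exact key _ _ _ rfl rfl

/-! ### Counting the degenerate conics of the pencil -/

open Classical in
/-- A scalar-invariant property of degenerate conics can only hold for the two conics at the
roots of `φ`. -/
theorem encard_degenerate (hf : Phi30 f g ≠ 0) (hab : a ≠ b)
    (hphi : phi f g = C (Phi30 f g) * (X - C a) ^ 2 * (X - C b)) {Pr : TernaryForm → Prop}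
    (hsmul : ∀ {q : TernaryForm}, Pr q → ∀ {c : ℝ}, c ≠ 0 → Pr (c • q))
    (hdisc : ∀ {q : TernaryForm}, Pr q → disc q = 0) :
    {p : Projectivization ℝ TernaryForm | p.rep ∈ pencil f g ∧ Pr p.rep}.encard =
      ((if Pr (a • f + g) then 1 else 0) + (if Pr (b • f + g) then 1 else 0) : ℕ) := by
  have hf' : disc f ≠ 0 := by rwa [← Phi30_eq f g]
  have hne (t : ℝ) (q : TernaryForm) (hq : disc q = 0) (h : t • f + q = 0) : t = 0 := by
    have h' : q = (-t) • f := by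
      calc q = (t • f + q) + (-t) • f := by module
        _ = (-t) • f := by rw [h, zero_add]
    rw [h', disc_smul] at hq
    simpa [hf'] using hq
  have hda : disc (a • f + g) = 0 := by rw [← eval_phi, hphi]; simp
  have hdb : disc (b • f + g) = 0 := by rw [← eval_phi, hphi]; simp
  -- Proportionality would make `(a - b) f` a multiple of the degenerate form `b f + g`.
  have hindep (c : ℝ) : a • f + g ≠ c • (b • f + g) := by
    intro h
    refine hab (sub_eq_zero.1 (hne (a - b) ((1 - c) • (b • f + g)) ?_ ?_))
    · rw [disc_smul, hdb, mul_zero]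
    · calc _ = a • f + g - c • (b • f + g) := by module
        _ = 0 := sub_eq_zero.2 h
  have hA : a • f + g ≠ 0 := fun h => hindep 0 (by rw [h, zero_smul])
  have hB : b • f + g ≠ 0 := by
    intro h
    refine hab (sub_eq_zero.1 (hne (a - b) (-(1 : ℝ) • (a • f + g)) ?_ ?_))
    · rw [disc_smul, hda, mul_zero]
    · calc _ = -(b • f + g) := by module
        _ = 0 := by rw [h, neg_zero]
  have hcases (q : TernaryForm) (hq : q ∈ pencil f g) (hq0 : q ≠ 0) (hd : disc q = 0) :
      ∃ c : ℝ, q = c • (a • f + g) ∨ q = c • (b • f + g) := by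
    rw [pencil, Submodule.mem_span_pair] at hq
    obtain ⟨u, v, rfl⟩ := hq
    have hv : v ≠ 0 := by
      rintro rfl
      rw [zero_smul, add_zero] at hd hq0
      rw [disc_smul] at hd
      have hu : u = 0 := by simpa [hf'] using hd
      simp [hu] at hq0
    have h : u • f + v • g = v • ((u / v) • f + g) := by
      rw [smul_add, smul_smul, mul_div_cancel₀ _ hv]
    rw [h, disc_smul, ← eval_phi, hphi] at hd
    simp only [eval_mul, eval_C, eval_pow, eval_sub, eval_X, mul_eq_zero, pow_eq_zero_iff,
      ne_eq, OfNat.ofNat_ne_zero, not_false_eq_true, hv, hf, false_or, sub_eq_zero] at hd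
    refine ⟨v, hd.imp ?_ ?_⟩ <;> intro hd <;> rw [h, hd]
  have hmk (t : ℝ) (ht : t • f + g ≠ 0) (q : TernaryForm) (hq : q ≠ 0) (c : ℝ)
      (hc : q = c • (t • f + g)) :
      Projectivization.mk ℝ q hq = Projectivization.mk ℝ (t • f + g) ht := by
    rw [Projectivization.mk_eq_mk_iff']
    exact ⟨c, hc.symm⟩
  -- The chosen representative of a projective point is only known up to a unit, whence the need for
  -- scalar invariance.
  have hrep (t : ℝ) (ht : t • f + g ≠ 0) :
      ((Projectivization.mk ℝ (t • f + g) ht).rep ∈ pencil f g ∧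
        Pr (Projectivization.mk ℝ (t • f + g) ht).rep) ↔ Pr (t • f + g) := by
    obtain ⟨c, hc⟩ := Projectivization.exists_smul_eq_mk_rep ℝ (t • f + g) ht
    rw [← hc]
    constructor
    · rintro ⟨-, h⟩
      have := hsmul h (c := (c : ℝ)⁻¹) (inv_ne_zero c.ne_zero)
      rwa [Units.smul_def, smul_smul, inv_mul_cancel₀ c.ne_zero, one_smul] at this
    · intro h
      refine ⟨Submodule.smul_mem _ _ (Submodule.add_mem _ (Submodule.smul_mem _ _ ?_) ?_),
        hsmul h c.ne_zero⟩
      · exact Submodule.subset_span (by simp)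
      · exact Submodule.subset_span (by simp)
  have hset : {p : Projectivization ℝ TernaryForm | p.rep ∈ pencil f g ∧ Pr p.rep} =
      {p | p = Projectivization.mk ℝ (a • f + g) hA ∧ Pr (a • f + g)} ∪
      {p | p = Projectivization.mk ℝ (b • f + g) hB ∧ Pr (b • f + g)} := by
    ext p
    simp only [Set.mem_ofPred_eq, Set.mem_union]
    constructor
    · intro h
      obtain ⟨c, hc⟩ := hcases p.rep h.1 p.rep_nonzero (hdisc h.2)
      refine hc.imp ?_ ?_ <;> intro hc <;> have := hmk _ (by assumption) _ p.rep_nonzero c hc <;>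
        rw [Projectivization.mk_rep] at this
      · rw [this] at h
        exact ⟨this, (hrep a hA).1 h⟩
      · rw [this] at h
        exact ⟨this, (hrep b hB).1 h⟩
    · rintro (⟨rfl, h⟩ | ⟨rfl, h⟩)
      · exact (hrep a hA).2 h
      · exact (hrep b hB).2 h
  have hpq : Projectivization.mk ℝ (a • f + g) hA ≠ Projectivization.mk ℝ (b • f + g) hB := by
    rw [ne_eq, Projectivization.mk_eq_mk_iff']
    rintro ⟨c, hc⟩
    exact hindep c hc.symm
  rw [hset, Set.encard_union_eq]
  · by_cases h1 : Pr (a • f + g) <;> by_cases h2 : Pr (b • f + g) <;> simp [h1, h2, one_add_one_eq_two]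
  · rw [Set.disjoint_left]
    rintro p ⟨rfl, -⟩ ⟨h, -⟩
    exact hpq h

open Classical in
theorem hasDegenerateConics (hf : Phi30 f g ≠ 0) (hab : a ≠ b)
    (hphi : phi f g = C (Phi30 f g) * (X - C a) ^ 2 * (X - C b)) :
    HasDegenerateConics f g
      ((if IsPairOfLines (a • f + g) then 1 else 0) +
        (if IsPairOfLines (b • f + g) then 1 else 0))
      ((if IsIsolatedPoint (a • f + g) then 1 else 0) +
        (if IsIsolatedPoint (b • f + g) then 1 else 0))
      ((if IsDoubleLine (a • f + g) then 1 else 0) +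
        (if IsDoubleLine (b • f + g) then 1 else 0)) :=
  ⟨encard_degenerate hf hab hphi IsPairOfLines.smul IsPairOfLines.disc_eq_zero,
    encard_degenerate hf hab hphi IsIsolatedPoint.smul IsIsolatedPoint.disc_eq_zero,
    encard_degenerate hf hab hphi IsDoubleLine.smul IsDoubleLine.disc_eq_zero⟩

end roots

/-! ### Sign conditions and counts for each orbit -/

/-- The signs of `ψ` at the double root and at the simple root of `φ`. -/
def Orbit.signs : Orbit → SignType × SignType
  | .II => (-1, -1)
  | .IIa => (1, -1)
  | .III => (0, -1)
  | .IIIa => (0, 1)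

/-- Here `u` and `v` stand for the values of `ψ` at the double and the simple root; the roots
themselves are no longer needed. -/
theorem GeneratesIn.signs {o : Orbit} {f g : TernaryForm} (hf : disc f ≠ 0)
    (h : GeneratesIn o f g) :
    ∃ u v : ℝ, SignType.sign u = o.signs.1 ∧ SignType.sign v = o.signs.2 ∧
      SignType.sign (p2 f g) = SignType.sign (v + 2 * u) ∧
      SignType.sign (Phi30 f g * A1 f g) = SignType.sign (u * v) ∧
      sturmQuery (psi f g) (phi f g) = (o.signs.1 : ℤ) + (o.signs.2 : ℤ) := by
  obtain ⟨a, b, hab, hphi, ha, hb⟩ := h.exists_roots hf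
  have hΦ : Phi30 f g ≠ 0 := by rwa [Phi30_eq]
  have hsa : SignType.sign ((psi f g).eval a) = o.signs.1 := by
    rw [eval_psi]
    cases o
    · exact sign_neg (IsPairOfLines.principalMinorSum_neg ha)
    · exact sign_pos (IsSumOfSquares.principalMinorSum_pos ha)
    · rw [IsDoubleLine.principalMinorSum_eq_zero ha, sign_zero, Orbit.signs]
    · rw [IsDoubleLine.principalMinorSum_eq_zero ha, sign_zero, Orbit.signs]
  have hsb : SignType.sign ((psi f g).eval b) = o.signs.2 := by
    rw [eval_psi]
    cases o
    · exact sign_neg (IsPairOfLines.principalMinorSum_neg hb)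
    · exact sign_neg (IsPairOfLines.principalMinorSum_neg hb)
    · exact sign_neg (IsPairOfLines.principalMinorSum_neg hb)
    · exact sign_pos (IsSumOfSquares.principalMinorSum_pos hb)
  refine ⟨_, _, hsa, hsb, ?_, ?_, ?_⟩
  · rw [p2_eq hΦ hab hphi, sign_mul, sign_pos (by positivity), one_mul]
  · have : a - b ≠ 0 := sub_ne_zero.2 hab
    rw [Phi30_mul_A1 hΦ hab hphi, sign_mul, sign_pos (by positivity), one_mul]
  · rw [sturmQuery_psi_phi hΦ hab hphi, hsa, hsb]

theorem GeneratesIn.p2_A1_of_II {f g : TernaryForm} (hf : disc f ≠ 0)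
    (h : GeneratesIn .II f g) : p2 f g < 0 ∧ 0 < Phi30 f g * A1 f g := by
  obtain ⟨u, v, hu, hv, hp, hA, -⟩ := h.signs hf
  have hu : u < 0 := sign_eq_neg_one_iff.1 hu
  have hv : v < 0 := sign_eq_neg_one_iff.1 hv
  rw [sign_neg (a := v + 2 * u) (by linarith), sign_eq_neg_one_iff] at hp
  rw [sign_pos (mul_pos_of_neg_of_neg hu hv), sign_eq_one_iff] at hA
  exact ⟨hp, hA⟩

/-- The signs `u > 0 > v` leave that of `v + 2 u` undetermined, so only the product is informative.
-/
theorem GeneratesIn.A1_of_IIa {f g : TernaryForm} (hf : disc f ≠ 0)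
    (h : GeneratesIn .IIa f g) : Phi30 f g * A1 f g < 0 := by
  obtain ⟨u, v, hu, hv, hp, hA, -⟩ := h.signs hf
  have hu : 0 < u := sign_eq_one_iff.1 hu
  have hv : v < 0 := sign_eq_neg_one_iff.1 hv
  rwa [sign_neg (mul_neg_of_pos_of_neg hu hv), sign_eq_neg_one_iff] at hA

theorem GeneratesIn.p2_of_III {f g : TernaryForm} (hf : disc f ≠ 0)
    (h : GeneratesIn .III f g) : p2 f g < 0 := by
  obtain ⟨u, v, hu, hv, hp, hA, -⟩ := h.signs hf
  have hu : u = 0 := sign_eq_zero_iff.1 hu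
  have hv : v < 0 := sign_eq_neg_one_iff.1 hv
  rwa [sign_neg (a := v + 2 * u) (by linarith), sign_eq_neg_one_iff] at hp

theorem GeneratesIn.p2_of_IIIa {f g : TernaryForm} (hf : disc f ≠ 0)
    (h : GeneratesIn .IIIa f g) : 0 < p2 f g := by
  obtain ⟨u, v, hu, hv, hp, hA, -⟩ := h.signs hf
  have hu : u = 0 := sign_eq_zero_iff.1 hu
  have hv : 0 < v := sign_eq_one_iff.1 hv
  rwa [sign_pos (a := v + 2 * u) (by linarith), sign_eq_one_iff] at hp

/-- The numbers of pairs of lines, isolated points and double lines in an orbit. -/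
def Orbit.conicCounts : Orbit → ℕ × ℕ × ℕ
  | .II => (2, 0, 0)
  | .IIa => (1, 1, 0)
  | .III => (1, 0, 1)
  | .IIIa => (0, 1, 1)

theorem GeneratesIn.hasDegenerateConics {o : Orbit} {f g : TernaryForm} (hf : disc f ≠ 0)
    (h : GeneratesIn o f g) :
    HasDegenerateConics f g o.conicCounts.1 o.conicCounts.2.1 o.conicCounts.2.2 := by
  obtain ⟨a, b, hab, hphi, ha, hb⟩ := h.exists_roots hf
  have hΦ : Phi30 f g ≠ 0 := by rwa [Phi30_eq]
  have key := ConicPencil.hasDegenerateConics hΦ hab hphi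
  have lines {q : TernaryForm} (h : IsPairOfLines q) :
      IsPairOfLines q ∧ ¬IsIsolatedPoint q ∧ ¬IsDoubleLine q :=
    ⟨h, h.not_isIsolatedPoint, h.not_isDoubleLine⟩
  have squares {q : TernaryForm} (h : IsSumOfSquares q) :
      ¬IsPairOfLines q ∧ IsIsolatedPoint q ∧ ¬IsDoubleLine q :=
    ⟨h.not_isPairOfLines, h.isIsolatedPoint, h.not_isDoubleLine⟩
  have double {q : TernaryForm} (h : IsDoubleLine q) :
      ¬IsPairOfLines q ∧ ¬IsIsolatedPoint q ∧ IsDoubleLine q :=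
    ⟨fun h' => h'.not_isDoubleLine h, h.not_isIsolatedPoint, h⟩
  cases o
  · simpa [Orbit.conicCounts, lines ha, lines hb] using key
  · simpa [Orbit.conicCounts, squares ha, lines hb] using key
  · simpa [Orbit.conicCounts, double ha, lines hb] using key
  · simpa [Orbit.conicCounts, double ha, squares hb] using key

end ConicPencil

end

theorem mainTheorem8 (f g : TernaryForm) (hf : disc f ≠ 0) (hg : disc g ≠ 0) :
    -- orbits II and IIa
    (GeneratesIn .II f g ∨ GeneratesIn .IIa f g →
      (GeneratesIn .II f g ↔ p2 f g < 0 ∧ 0 < Phi30 f g * A1 f g) ∧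
      (GeneratesIn .IIa f g ↔ p2 f g = 0 ∨ Phi30 f g * A1 f g < 0)) ∧
    -- orbits III and IIIa
    (GeneratesIn .III f g ∨ GeneratesIn .IIIa f g →
      (GeneratesIn .III f g ↔ p2 f g < 0) ∧
      (GeneratesIn .IIIa f g ↔ 0 < p2 f g)) ∧
    -- the degenerate conics of the pencil, and the Sturm query of `ψ` for `φ`
    (GeneratesIn .II f g →
      HasDegenerateConics f g 2 0 0 ∧ sturmQuery (psi f g) (phi f g) = -2) ∧
    (GeneratesIn .IIa f g →
      HasDegenerateConics f g 1 1 0 ∧ sturmQuery (psi f g) (phi f g) = 0) ∧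
    (GeneratesIn .III f g →
      HasDegenerateConics f g 1 0 1 ∧ sturmQuery (psi f g) (phi f g) = -1) ∧
    (GeneratesIn .IIIa f g →
      HasDegenerateConics f g 0 1 1 ∧ sturmQuery (psi f g) (phi f g) = 1) := by
  have hs (o : Orbit) (h : GeneratesIn o f g) :
      sturmQuery (psi f g) (phi f g) = (o.signs.1 : ℤ) + (o.signs.2 : ℤ) := by
    obtain ⟨-, -, -, -, -, -, h⟩ := h.signs hf
    exact h
  refine ⟨fun h => ⟨⟨fun h => h.p2_A1_of_II hf, fun hp => ?_⟩,
      ⟨fun h => .inr (h.A1_of_IIa hf), fun hp => ?_⟩⟩,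
    fun h => ⟨⟨fun h => h.p2_of_III hf, fun hp => ?_⟩,
      ⟨fun h => h.p2_of_IIIa hf, fun hp => ?_⟩⟩,
    fun h => ⟨h.hasDegenerateConics hf, hs _ h⟩, fun h => ⟨h.hasDegenerateConics hf, hs _ h⟩,
    fun h => ⟨h.hasDegenerateConics hf, hs _ h⟩, fun h => ⟨h.hasDegenerateConics hf, hs _ h⟩⟩
  -- All converses hold because the other orbit of the pair forces an incompatible sign.
  · exact h.resolve_right fun h => (h.A1_of_IIa hf).not_gt hp.2
  · refine h.resolve_left fun h => ?_
    have := h.p2_A1_of_II hf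
    exact hp.elim this.1.ne fun hA => hA.not_gt this.2
  · exact h.resolve_right fun h => (h.p2_of_IIIa hf).not_gt hp
  · exact h.resolve_left fun h => (h.p2_of_III hf).not_gt hp
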